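/- A weighted graph $(E,\omega)$ consists of countable sets $E^0$ (vertices) and $E^{\mathrm{st}}$ (structured edges), maps $s,r:E^{\mathrm{st}}\to E^0$ and a weight map $\omega:E^{\mathrm{st}}\to\{1,2,3,\dots\}$. It is assumed to be row-finite: $s^{-1}(v)$ is finite for every $v\in E^0$. Each $\alpha\in E^{\mathrm{st}}$ gives rise to $\omega(\alpha)$ distinct edges $\alpha_1,\dots,\alpha_{\omega(\alpha)}$. If $s^{-1}(v)\neq\emptyset$, put $\omega(v)=\max\{\omega(\alpha)\mid s(\alpha)=v\}$. For a (not necessarily commutative) unital ring $R$, the weighted Leavitt path algebra $L_R(E,\omega)$ is the (not necessarily unital) ring $R\langle X\rangle/I$. Here $X$ is the disjoint union of $E^0$, the set of all edges $\alpha_i$, and the set of all symbols $\alpha_i^*$; $R\langle X\rangle$ is the free left $R$-module on the nonempty words over $X$, with multiplication determined by $(ax)(by)=(ab)(xy)$ for $a,b\in R$ and words $x,y$; and $I$ is the smallest two-sided ideal that is an $R$-subbimodule and contains the relations 1. $vw=\delta_{vw}v$ for $v,w\in E^0$; 2. $s(\alpha)\alpha_i=\alpha_i=\alpha_i r(\alpha)$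 and $r(\alpha)\alpha_i^*=\alpha_i^*=\alpha_i^*s(\alpha)$ for $\alpha\in E^{\mathrm{st}}$, $1\le i\le\omega(\alpha)$; 3. $\sum_{s(\alpha)=v}\alpha_i\alpha_j^*=\delta_{ij}v$ for $v\in E^0$ with $s^{-1}(v)\ne\emptyset$ and $1\le i,j\le\omega(v)$; 4. $\sum_{1\le i\le\max\{\omega(\alpha),\omega(\beta)\}}\alpha_i^*\beta_i=\delta_{\alpha\beta}r(\alpha)$ for $\alpha,\beta\in E^{\mathrm{st}}$, where $\alpha_i$ and $\alpha_i^*$ are read as $0$ if $i>\omega(\alpha)$. It is a $\mathbb Z^n$-graded ring with $\deg v=0$, $\deg\alpha_i=e_i$, $\deg\alpha_i^*=-e_i$ and the elements of $R$ in degree $0$, where $n$ is the largest weight (if the weights are unbounded, $\mathbb Z^n$ is replaced by the direct sum of countably many copies of $\mathbb Z$). $(E,\omega)$ is called an LV-graph if $E^{\mathrm{st}}\neq\emptyset$; any two vertices are joined by a path that may traverse structured edges in either direction; $\omega(\alpha)\ge 2$ for all $\alpha\in E^{\mathrm{st}}$; and for every $v\in E^0$ with $s^{-1}(v)\ne\emptyset$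 there are at least two $\alpha\in s^{-1}(v)$ with $\omega(\alpha)=\omega(v)$. A ring $A$ is von Neumann regular if for every $a\in A$ there is $b\in A$ with $aba=a$. A graded ring $A$ is graded von Neumann regular if this holds for every homogeneous $a\in A$. **Theorem.** Let $(E,\omega)$ be an LV-graph and let $R$ be a domain (a nonzero unital ring, not necessarily commutative, without zero divisors). Then $L_R(E,\omega)$ is not graded von Neumann regular, and hence not von Neumann regular. -/

import Mathlib

/-- A ring `A`, not necessarily with unit, is von Neumann regular if for every `a` there is
`b` with `a b a = a`. -/
def IsVonNeumannRegular (A : Type*) [NonUnitalRing A] : Prop :=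
  ∀ a : A, ∃ b : A, a * b * a = a

/-- A graded ring `A = ⨁ g, 𝒜 g`, not necessarily with unit, is graded von Neumann regular if
for every homogeneous `a` there is `b` in `A` with `a b a = a`. -/
def IsGradedVonNeumannRegular {ι A : Type*} [DecidableEq ι] [Add ι] [NonUnitalRing A]
    (𝒜 : ι → AddSubgroup A) [SetLike.GradedMul 𝒜] [DirectSum.Decomposition 𝒜] : Prop :=
  ∀ a : A, SetLike.IsHomogeneousElem 𝒜 a → ∃ b : A, a * b * a = a

/-- A row-finite weighted graph with set of vertices `V` and set of structured edges `S`. -/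
structure WeightedGraph (V S : Type*) where
  src : S → V
  tgt : S → V
  weight : S → ℕ
  weight_pos : ∀ α, 0 < weight α
  rowFinite : ∀ v, {α | src α = v}.Finite

namespace WeightedGraph

variable {V S : Type*} (E : WeightedGraph V S)

/-- The finite set `s⁻¹(v)` of structured edges emitted by `v`. -/
noncomputable def out (v : V) : Finset S := (E.rowFinite v).toFinset

/-- `ω(v)`: the largest weight of a structured edge emitted by `v` (and `0` if `v` is a sink). -/
noncomputable def maxWeight (v : V) : ℕ := (E.out v).sup E.weight

/-- The alphabet: vertices `v`, edges `α_i` and ghost edges `α_i*`. The indices `i` of the edges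
of a structured edge `α` run through `0, …, ω(α) - 1` (instead of `1, …, ω(α)`). -/
inductive Letter : Type _
  | vertex (v : V) : Letter
  | edge (α : S) (i : Fin (E.weight α)) : Letter
  | ghost (α : S) (i : Fin (E.weight α)) : Letter

/-- One step of a generalised path: an edge from `u` to `v`, or a ghost edge from `u` to `v`
(that is, an edge from `v` to `u`). Every structured edge has at least one edge. -/
def Step (u v : V) : Prop :=
  ∃ α, (E.src α = u ∧ E.tgt α = v) ∨ (E.tgt α = u ∧ E.src α = v)

/-- LV-graphs. Connectedness: any two vertices are joined by a generalised path (there is at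
least one vertex since there is at least one structured edge). -/
structure IsLV : Prop where
  two_le_weight : ∀ α, 2 ≤ E.weight α
  two_le_card : ∀ v, (E.out v).Nonempty →
    2 ≤ ((E.out v).filter (fun α => E.weight α = E.maxWeight v)).card
  nonempty : Nonempty S
  connected : ∀ u v, Relation.ReflTransGen E.Step u v

section Algebra

variable (R : Type*) [Ring R]

/-- The free `R`-ring `R⟨X⟩` (without unit) on the alphabet `X`: the free left `R`-module on the
nonempty words, with multiplication `(r x) (s y) = (r s) (x y)`. -/
abbrev FreeRRing : Type _ := MonoidAlgebra R (FreeSemigroup E.Letter)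

/-- The vertex `v` as an element of the free `R`-ring. -/
noncomputable def freeVertex (v : V) : E.FreeRRing R :=
  MonoidAlgebra.single (FreeSemigroup.of (Letter.vertex v)) 1

/-- The edge `α_i` as an element of the free `R`-ring; it is zero if `i` is not an index of an edge
of `α`. -/
noncomputable def freeEdge (α : S) (i : ℕ) : E.FreeRRing R :=
  if h : i < E.weight α then
    MonoidAlgebra.single (FreeSemigroup.of (Letter.edge α ⟨i, h⟩)) 1 else 0

/-- The ghost edge `α_i*` as an element of the free `R`-ring; it is zero if `i` is not an index of
an edge of `α`. -/
noncomputable def freeGhost (α : S) (i : ℕ) : E.FreeRRing R :=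
  if h : i < E.weight α then
    MonoidAlgebra.single (FreeSemigroup.of (Letter.ghost α ⟨i, h⟩)) 1 else 0

open Classical in
/-- The defining relations of the weighted Leavitt path algebra. -/
inductive Rel : E.FreeRRing R → E.FreeRRing R → Prop
  | vertex_mul (v w : V) :
      Rel (E.freeVertex R v * E.freeVertex R w) (if v = w then E.freeVertex R v else 0)
  | src_mul_edge (α : S) (i : ℕ) (hi : i < E.weight α) :
      Rel (E.freeVertex R (E.src α) * E.freeEdge R α i) (E.freeEdge R α i)
  | edge_mul_tgt (α : S) (i : ℕ) (hi : i < E.weight α) :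
      Rel (E.freeEdge R α i * E.freeVertex R (E.tgt α)) (E.freeEdge R α i)
  | tgt_mul_ghost (α : S) (i : ℕ) (hi : i < E.weight α) :
      Rel (E.freeVertex R (E.tgt α) * E.freeGhost R α i) (E.freeGhost R α i)
  | ghost_mul_src (α : S) (i : ℕ) (hi : i < E.weight α) :
      Rel (E.freeGhost R α i * E.freeVertex R (E.src α)) (E.freeGhost R α i)
  | sum_edge_mul_ghost (v : V) (i j : ℕ) (hi : i < E.maxWeight v) (hj : j < E.maxWeight v) :
      Rel (∑ α ∈ E.out v, E.freeEdge R α i * E.freeGhost R α j)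
        (if i = j then E.freeVertex R v else 0)
  | sum_ghost_mul_edge (α β : S) :
      Rel (∑ i ∈ Finset.range (max (E.weight α) (E.weight β)),
          E.freeGhost R α i * E.freeEdge R β i)
        (if α = β then E.freeVertex R (E.tgt α) else 0)

/-- The ideal of the `R`-ring `R⟨X⟩` generated by the defining relations: the smallest two-sided
ideal that is an `R`-subbimodule and contains `x - y` for every defining relation `x = y`. -/
noncomputable def relIdeal : TwoSidedIdeal (E.FreeRRing R) :=
  sInf {I | (∀ x y, E.Rel R x y → x - y ∈ I) ∧
    ∀ (r : R) (x : E.FreeRRing R), x ∈ I → r • x ∈ I ∧ MulOpposite.op r • x ∈ I}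

/-- The weighted Leavitt path algebra `L_R(E, ω)`, a ring that need not have a unit. -/
def LeavittPathAlgebra : Type _ := (E.relIdeal R).ringCon.Quotient

noncomputable instance : NonUnitalRing (E.LeavittPathAlgebra R) :=
  inferInstanceAs (NonUnitalRing (E.relIdeal R).ringCon.Quotient)

/-- The quotient map from the free `R`-ring to the weighted Leavitt path algebra. -/
noncomputable def toLeavitt : E.FreeRRing R →ₙ+* E.LeavittPathAlgebra R where
  toFun x := ((x : (E.relIdeal R).ringCon.Quotient))
  map_mul' _ _ := rfl
  map_add' _ _ := rfl
  map_zero' := rfl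

end Algebra

section Grading

/-- The indices of edges that occur in the graph. If the weights have a maximum `n`, there are
exactly `n` of them. -/
abbrev Layer : Type := {i : ℕ // ∃ α, i < E.weight α}

/-- The grading group `ℤⁿ`, where `n` is the largest weight (the free abelian group on countably
many generators if the weights are unbounded). -/
abbrev GradingGroup : Type := E.Layer →₀ ℤ

/-- The degree of a letter: `deg v = 0`, `deg α_i = e_i`, `deg α_i* = -e_i`. -/
noncomputable def letterDegree : E.Letter → E.GradingGroup
  | Letter.vertex _ => 0
  | Letter.edge α i => Finsupp.single ⟨i, α, i.2⟩ 1
  | Letter.ghost α i => -Finsupp.single ⟨i, α, i.2⟩ 1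

/-- The degree of a word: the sum of the degrees of its letters. -/
noncomputable def degree (w : FreeSemigroup E.Letter) : E.GradingGroup :=
  (FreeSemigroup.lift (fun x => Multiplicative.ofAdd (E.letterDegree x)) w).toAdd

variable (R : Type*) [Ring R]

/-- The elements of the free `R`-ring all of whose words have degree `g`. -/
def freeComponent (g : E.GradingGroup) : AddSubgroup (E.FreeRRing R) where
  carrier := {x | ∀ w, x.coeff w ≠ 0 → E.degree w = g}
  zero_mem' := by intro w hw; simp at hw
  add_mem' := by
    intro x y hx hy w hw
    by_cases h : x.coeff w = 0
    · exact hy w (by intro h'; exact hw (by simp [h, h']))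
    · exact hx w h
  neg_mem' := by
    intro x hx w hw
    exact hx w (by simpa using hw)

/-- The homogeneous component of degree `g` of the weighted Leavitt path algebra. -/
noncomputable def component (g : E.GradingGroup) : AddSubgroup (E.LeavittPathAlgebra R) :=
  (E.freeComponent R g).map (E.toLeavitt R : E.FreeRRing R →+ E.LeavittPathAlgebra R)

/-! The components form a grading of the weighted Leavitt path algebra. -/

variable {E R}

theorem degree_of (x : E.Letter) : E.degree (FreeSemigroup.of x) = E.letterDegree x := by
  simp [degree]

theorem degree_mul (w w' : FreeSemigroup E.Letter) :
    E.degree (w * w') = E.degree w + E.degree w' := by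
  simp [degree]

theorem single_mem_freeComponent (w : FreeSemigroup E.Letter) (r : R) :
    MonoidAlgebra.single w r ∈ E.freeComponent R (E.degree w) := by
  classical
  intro w' hw'
  rw [MonoidAlgebra.coeff_single, Finsupp.single_apply] at hw'
  split_ifs at hw' with h
  · rw [h]
  · exact absurd rfl hw'

theorem mul_mem_freeComponent {g h : E.GradingGroup} {x y : E.FreeRRing R}
    (hx : x ∈ E.freeComponent R g) (hy : y ∈ E.freeComponent R h) :
    x * y ∈ E.freeComponent R (g + h) := by
  classical
  rw [MonoidAlgebra.mul_def]
  refine AddSubgroup.sum_mem _ fun a ha => AddSubgroup.sum_mem _ fun b hb => ?_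
  rw [← hx a (Finsupp.mem_support_iff.mp ha), ← hy b (Finsupp.mem_support_iff.mp hb),
    ← degree_mul]
  exact single_mem_freeComponent _ _

theorem mul_mem_component {g h : E.GradingGroup} {x y : E.LeavittPathAlgebra R}
    (hx : x ∈ E.component R g) (hy : y ∈ E.component R h) : x * y ∈ E.component R (g + h) := by
  obtain ⟨x, hx, rfl⟩ := hx
  obtain ⟨y, hy, rfl⟩ := hy
  exact ⟨x * y, mul_mem_freeComponent hx hy, map_mul (E.toLeavitt R) x y⟩

theorem toLeavitt_eq_zero_iff (x : E.FreeRRing R) : E.toLeavitt R x = 0 ↔ x ∈ E.relIdeal R := by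
  rw [TwoSidedIdeal.mem_iff]
  exact RingCon.eq _

theorem toLeavitt_surjective : Function.Surjective (E.toLeavitt R) := Quotient.mk''_surjective

theorem sub_mem_relIdeal {x y : E.FreeRRing R} (h : E.Rel R x y) : x - y ∈ E.relIdeal R := by
  rw [relIdeal, TwoSidedIdeal.mem_sInf]
  exact fun I hI => hI.1 x y h

theorem smul_mem_relIdeal {x : E.FreeRRing R} (hx : x ∈ E.relIdeal R) (r : R) :
    r • x ∈ E.relIdeal R ∧ MulOpposite.op r • x ∈ E.relIdeal R := by
  rw [relIdeal, TwoSidedIdeal.mem_sInf] at hx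
  rw [relIdeal, TwoSidedIdeal.mem_sInf, TwoSidedIdeal.mem_sInf]
  exact ⟨fun I hI => (hI.2 r x (hx I hI)).1, fun I hI => (hI.2 r x (hx I hI)).2⟩

open Classical in
/-- The projection of the free `R`-ring to its elements of degree `g`. -/
noncomputable def proj (g : E.GradingGroup) : E.FreeRRing R →+ E.FreeRRing R where
  toFun x := MonoidAlgebra.ofCoeff (x.coeff.filter (fun w => E.degree w = g))
  map_zero' := by rw [MonoidAlgebra.coeff_zero, Finsupp.filter_zero]; rfl
  map_add' x y := by simp [Finsupp.filter_add]

open Classical in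
theorem proj_single (g : E.GradingGroup) (w : FreeSemigroup E.Letter) (r : R) :
    proj g (MonoidAlgebra.single w r) =
      if E.degree w = g then MonoidAlgebra.single w r else 0 := by
  unfold proj
  split_ifs with h
  · simp [Finsupp.filter_single_of_pos, h]
  · simp [Finsupp.filter_single_of_neg, h]

open Classical in
theorem proj_of_mem {g h : E.GradingGroup} {x : E.FreeRRing R} (hx : x ∈ E.freeComponent R g) :
    proj h x = if g = h then x else 0 := by
  ext w
  simp only [proj, AddMonoidHom.coe_mk, ZeroHom.coe_mk, Finsupp.filter_apply]
  by_cases hw : x.coeff w = 0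
  · split_ifs <;> simp [hw]
  · rw [hx w hw]
    split_ifs <;> simp

theorem proj_smul (g : E.GradingGroup) (r : R) (x : E.FreeRRing R) :
    proj g (r • x) = r • proj g x := by
  ext w
  simp only [proj, AddMonoidHom.coe_mk, ZeroHom.coe_mk, Finsupp.filter_apply,
    MonoidAlgebra.coeff_smul_apply]
  split_ifs <;> simp

theorem proj_op_smul (g : E.GradingGroup) (r : R) (x : E.FreeRRing R) :
    proj g (MulOpposite.op r • x) = MulOpposite.op r • proj g x := by
  ext w
  simp only [proj, AddMonoidHom.coe_mk, ZeroHom.coe_mk, Finsupp.filter_apply,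
    MonoidAlgebra.coeff_smul_apply]
  split_ifs <;> simp

theorem proj_single_mul (g : E.GradingGroup) (w : FreeSemigroup E.Letter) (r : R)
    (x : E.FreeRRing R) : proj g (MonoidAlgebra.single w r * x) =
      MonoidAlgebra.single w r * proj (g - E.degree w) x := by
  induction x using MonoidAlgebra.induction_linear with
  | zero => simp
  | add x y hx hy => simp only [mul_add, map_add, hx, hy]
  | single w' s =>
    rw [MonoidAlgebra.single_mul_single, proj_single, proj_single, degree_mul]
    by_cases h : E.degree w' = g - E.degree w
    · rw [if_pos h, if_pos (by rw [h]; abel), MonoidAlgebra.single_mul_single]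
    · rw [if_neg h, if_neg (by rintro rfl; exact h (by abel)), mul_zero]

theorem proj_mul_single (g : E.GradingGroup) (w : FreeSemigroup E.Letter) (r : R)
    (x : E.FreeRRing R) : proj g (x * MonoidAlgebra.single w r) =
      proj (g - E.degree w) x * MonoidAlgebra.single w r := by
  induction x using MonoidAlgebra.induction_linear with
  | zero => simp
  | add x y hx hy => simp only [add_mul, map_add, hx, hy]
  | single w' s =>
    rw [MonoidAlgebra.single_mul_single, proj_single, proj_single, degree_mul]
    by_cases h : E.degree w' = g - E.degree w
    · rw [if_pos h, if_pos (by rw [h]; abel), MonoidAlgebra.single_mul_single]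
    · rw [if_neg h, if_neg (by rintro rfl; exact h (by abel)), zero_mul]

theorem freeVertex_mem (v : V) : E.freeVertex R v ∈ E.freeComponent R 0 := by
  have h := single_mem_freeComponent (R := R) (FreeSemigroup.of (Letter.vertex (E := E) v)) 1
  rwa [degree_of] at h

theorem freeEdge_mem (α : S) (i : ℕ) (hi : i < E.weight α) :
    E.freeEdge R α i ∈ E.freeComponent R (Finsupp.single ⟨i, α, hi⟩ 1) := by
  have h := single_mem_freeComponent (R := R)
    (FreeSemigroup.of (Letter.edge (E := E) α ⟨i, hi⟩)) 1
  rw [degree_of] at h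
  rw [freeEdge, dif_pos hi]
  exact h

theorem freeGhost_mem (α : S) (i : ℕ) (hi : i < E.weight α) :
    E.freeGhost R α i ∈ E.freeComponent R (-Finsupp.single ⟨i, α, hi⟩ 1) := by
  have h := single_mem_freeComponent (R := R)
    (FreeSemigroup.of (Letter.ghost (E := E) α ⟨i, hi⟩)) 1
  rw [degree_of] at h
  rw [freeGhost, dif_pos hi]
  exact h

theorem Rel.homogeneous {x y : E.FreeRRing R} (h : E.Rel R x y) :
    ∃ g, x - y ∈ E.freeComponent R g := by
  classical
  have key : ∀ g, x ∈ E.freeComponent R g → y ∈ E.freeComponent R g →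
      ∃ g, x - y ∈ E.freeComponent R g := fun g hx hy => ⟨g, sub_mem hx hy⟩
  cases h with
  | vertex_mul v w =>
    refine key 0 ?_ ?_
    · simpa using mul_mem_freeComponent (freeVertex_mem (R := R) v) (freeVertex_mem w)
    · split_ifs
      · exact freeVertex_mem v
      · exact zero_mem _
  | src_mul_edge α i hi =>
    refine key _ ?_ (freeEdge_mem α i hi)
    simpa using mul_mem_freeComponent (freeVertex_mem (R := R) (E.src α)) (freeEdge_mem α i hi)
  | edge_mul_tgt α i hi =>
    refine key _ ?_ (freeEdge_mem α i hi)
    simpa using mul_mem_freeComponent (freeEdge_mem (R := R) α i hi) (freeVertex_mem (E.tgt α))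
  | tgt_mul_ghost α i hi =>
    refine key _ ?_ (freeGhost_mem α i hi)
    simpa using mul_mem_freeComponent (freeVertex_mem (R := R) (E.tgt α)) (freeGhost_mem α i hi)
  | ghost_mul_src α i hi =>
    refine key _ ?_ (freeGhost_mem α i hi)
    simpa using mul_mem_freeComponent (freeGhost_mem (R := R) α i hi) (freeVertex_mem (E.src α))
  | sum_edge_mul_ghost v i j hi hj =>
    have hex : ∀ k, k < E.maxWeight v → ∃ α, k < E.weight α := by
      intro k hk
      obtain ⟨α, -, hα⟩ := Finset.lt_sup_iff.mp hk
      exact ⟨α, hα⟩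
    refine key (Finsupp.single ⟨i, hex i hi⟩ 1 + -Finsupp.single ⟨j, hex j hj⟩ 1) ?_ ?_
    · refine AddSubgroup.sum_mem _ fun α _ => ?_
      by_cases h1 : i < E.weight α
      · by_cases h2 : j < E.weight α
        · exact mul_mem_freeComponent (freeEdge_mem α i h1) (freeGhost_mem α j h2)
        · simp [freeGhost, h2]
      · simp [freeEdge, h1]
    · split_ifs with h
      · subst h
        simpa using freeVertex_mem (R := R) v
      · exact zero_mem _
  | sum_ghost_mul_edge α β =>
    refine key 0 ?_ ?_
    · refine AddSubgroup.sum_mem _ fun i _ => ?_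
      by_cases h1 : i < E.weight α
      · by_cases h2 : i < E.weight β
        · simpa using mul_mem_freeComponent (freeGhost_mem (R := R) α i h1) (freeEdge_mem β i h2)
        · simp [freeEdge, h2]
      · simp [freeGhost, h1]
    · split_ifs
      · exact freeVertex_mem _
      · exact zero_mem _

theorem proj_mem_relIdeal {x : E.FreeRRing R} (hx : x ∈ E.relIdeal R) (g : E.GradingGroup) :
    proj g x ∈ E.relIdeal R := by
  classical
  let J : TwoSidedIdeal (E.FreeRRing R) := TwoSidedIdeal.mk'
    {x | ∀ g, proj g x ∈ E.relIdeal R}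
    (fun g => by rw [map_zero]; exact zero_mem _)
    (fun hx hy g => by rw [map_add]; exact add_mem (hx g) (hy g))
    (fun hx g => by rw [map_neg]; exact neg_mem (hx g))
    (by
      intro x y hy g
      induction x using MonoidAlgebra.induction_linear with
      | zero => rw [zero_mul, map_zero]; exact zero_mem _
      | add a b ha hb => rw [add_mul, map_add]; exact add_mem ha hb
      | single w r =>
        rw [proj_single_mul]
        exact TwoSidedIdeal.mul_mem_left _ _ _ (hy _))
    (by
      intro x y hx g
      induction y using MonoidAlgebra.induction_linear with
      | zero => rw [mul_zero, map_zero]; exact zero_mem _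
      | add a b ha hb => rw [mul_add, map_add]; exact add_mem ha hb
      | single w r =>
        rw [proj_mul_single]
        exact TwoSidedIdeal.mul_mem_right _ _ _ (hx _))
  have hJ : ∀ x, x ∈ J ↔ ∀ g, proj g x ∈ E.relIdeal R := fun x => TwoSidedIdeal.mem_mk' ..
  have hxJ : x ∈ J := by
    rw [relIdeal, TwoSidedIdeal.mem_sInf] at hx
    refine hx J ⟨fun a b hab => ?_, fun r y hy => ?_⟩
    · rw [hJ]
      intro g
      obtain ⟨k, hk⟩ := hab.homogeneous
      rw [proj_of_mem hk]
      split_ifs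
      · exact sub_mem_relIdeal hab
      · exact zero_mem _
    · rw [hJ] at hy
      refine ⟨(hJ _).2 fun g => ?_, (hJ _).2 fun g => ?_⟩
      · rw [proj_smul]
        exact (smul_mem_relIdeal (hy g) r).1
      · rw [proj_op_smul]
        exact (smul_mem_relIdeal (hy g) r).2
  exact (hJ x).1 hxJ g

theorem isInternal_component : DirectSum.IsInternal (E.component R) := by
  classical
  constructor
  · rw [injective_iff_map_eq_zero]
    intro d hd
    have hrep : ∀ i, ∃ f ∈ E.freeComponent R i,
        E.toLeavitt R f = (d i : E.LeavittPathAlgebra R) := fun i => (d i).2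
    choose f hf hfd using hrep
    rw [DirectSum.coeAddMonoidHom_eq_dfinsuppSum, DFinsupp.sum] at hd
    have h0 : (∑ i ∈ d.support, f i) ∈ E.relIdeal R := by
      rw [← toLeavitt_eq_zero_iff, map_sum]
      simpa only [hfd] using hd
    ext g
    by_cases hg : g ∈ d.support
    · have h1 := proj_mem_relIdeal h0 g
      rw [map_sum, Finset.sum_congr rfl (fun i _ => proj_of_mem (hf i)),
        Finset.sum_ite_eq' , if_pos hg, ← toLeavitt_eq_zero_iff, hfd] at h1
      simpa using h1
    · simpa using hg
  · intro a
    obtain ⟨x, rfl⟩ := toLeavitt_surjective a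
    induction x using MonoidAlgebra.induction_linear with
    | zero => exact ⟨0, by simp⟩
    | add x y hx hy =>
      obtain ⟨a, ha⟩ := hx
      obtain ⟨b, hb⟩ := hy
      exact ⟨a + b, by rw [map_add, map_add, ha, hb]⟩
    | single w r =>
      exact ⟨DirectSum.of (fun g => E.component R g) (E.degree w)
        ⟨E.toLeavitt R (MonoidAlgebra.single w r), _, single_mem_freeComponent w r, rfl⟩,
        by rw [DirectSum.coeAddMonoidHom_of]⟩

instance : SetLike.GradedMul (E.component R) where
  mul_mem _ _ _ _ hx hy := mul_mem_component hx hy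

noncomputable instance : DirectSum.Decomposition (E.component R) :=
  isInternal_component.chooseDecomposition

end Grading

end WeightedGraph

/-!
Let `α ≠ β` have the same source and weights at least `2`, and let `T = R[X]`. Cutting the sets
`{v} × ℕ` into infinite pieces makes the algebra act on the free module with basis `V × ℕ` over `T`,
every edge being a partial bijection of the basis. At each vertex the edges form an invertible
matrix, and the relations survive an elementary column operation `α_i ↦ α_i + β_i x`. Take for `x`
the matrix unit with coefficient `X` from a basis vector in the range of `α_1*` to one in the range
of `β_0*` (indices start at `0`), so that only `α_0` changes and it gains a matrix unit whose row
and column were zero before. Comparing the corresponding entries in `α_0 b α_0 = α_0` gives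
`X c X = X` for some `c` in `R[X]`, which is impossible.
-/

theorem disjoint_range_sectR {ι : Type*} (κ : Type*) {a b : ι} (h : a ≠ b) :
    Disjoint (Set.range (Function.Embedding.sectR a κ))
      (Set.range (Function.Embedding.sectR b κ)) :=
  Set.disjoint_range_iff.2 fun _ _ hkl => h (congrArg Prod.fst hkl)

/-- The embeddings `f a`, for `a` in the finite set `s`, cut the range of `ρ` into pairwise disjoint
pieces. -/
structure IsRangePartition {ι κ Y : Type*} (s : Finset ι) (f : ι → κ ↪ Y) (ρ : κ ↪ Y) :
    Prop where
  pairwiseDisjoint : (s : Set ι).PairwiseDisjoint fun a => Set.range (f a)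
  iUnion_range : ⋃ a ∈ s, Set.range (f a) = Set.range ρ

theorem IsRangePartition.range_subset {ι κ Y : Type*} {s : Finset ι} {f : ι → κ ↪ Y} {ρ : κ ↪ Y}
    (h : IsRangePartition s f ρ) {a : ι} (ha : a ∈ s) : Set.range (f a) ⊆ Set.range ρ :=
  h.iUnion_range ▸ Set.subset_biUnion_of_mem (u := fun a => Set.range (f a)) ha

theorem IsRangePartition.congr {ι κ Y : Type*} {s : Finset ι} {f g : ι → κ ↪ Y} {ρ : κ ↪ Y}
    (h : IsRangePartition s f ρ) (hfg : ∀ a ∈ s, f a = g a) : IsRangePartition s g ρ where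
  pairwiseDisjoint a ha b hb hab := by
    simpa only [Function.onFun, hfg a ha, hfg b hb] using h.pairwiseDisjoint ha hb hab
  iUnion_range := by
    rw [← h.iUnion_range]
    exact Set.iUnion₂_congr fun a ha => by rw [hfg a ha]

theorem exists_isRangePartition {ι Y : Type*} {s : Finset ι} (hs : s.Nonempty) (ρ : ℕ ↪ Y) :
    ∃ f : ι → ℕ ↪ Y, IsRangePartition s f ρ := by
  classical
  have : Nonempty s := hs.to_subtype
  obtain ⟨φ⟩ : Nonempty (s × ℕ ≃ ℕ) := nonempty_equiv_of_countable
  let f : s → ℕ ↪ Y := fun a => (Function.Embedding.sectR a ℕ).trans (φ.toEmbedding.trans ρ)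
  have hf : ∀ a k, f a k = ρ (φ (a, k)) := fun _ _ => rfl
  refine ⟨fun a => if h : a ∈ s then f ⟨a, h⟩ else ρ, ⟨?_, ?_⟩⟩
  · rintro a ha b hb hab
    rw [Finset.mem_coe] at ha hb
    simp only [Function.onFun, dif_pos ha, dif_pos hb]
    refine Set.disjoint_range_iff.2 fun k l hkl => hab ?_
    rw [hf, hf] at hkl
    exact congrArg (fun p : s × ℕ => (p.1 : ι)) (φ.injective (ρ.injective hkl))
  · ext y
    simp only [Set.mem_iUnion, Set.mem_range]
    constructor
    · rintro ⟨a, ha, k, rfl⟩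
      exact ⟨φ (⟨a, ha⟩, k), by rw [dif_pos ha, hf]⟩
    · rintro ⟨n, rfl⟩
      exact ⟨(φ.symm n).1, (φ.symm n).1.2, (φ.symm n).2,
        by rw [dif_pos (φ.symm n).1.2, hf, Prod.mk.eta, φ.apply_symm_apply]⟩

section MonomialMaps

variable {κ Y : Type*} (T : Type*) [Ring T]

/-- The partial shift `δ_{τ k} ↦ δ_{σ k}`, which kills the basis vectors outside the range of `τ`.
Linearity is with respect to right multiplication, so that left multiplication by elements of `T`
is an endomorphism. -/
noncomputable def partialShift (σ τ : κ ↪ Y) : Module.End Tᵐᵒᵖ (Y →₀ T) :=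
  Finsupp.lmapDomain T Tᵐᵒᵖ σ ∘ₗ Finsupp.lcomapDomain τ τ.injective

variable {T}

/-- The matrix unit `E_{y z}` with coefficient `t`: it maps `δ_z` to `t δ_y` and kills the other
basis vectors. -/
noncomputable def matrixUnit (y z : Y) (t : T) : Module.End Tᵐᵒᵖ (Y →₀ T) :=
  Finsupp.lsingle y ∘ₗ Module.toModuleEnd Tᵐᵒᵖ T t ∘ₗ Finsupp.lapply z

theorem partialShift_apply_single (σ τ : κ ↪ Y) (k : κ) (c : T) :
    partialShift T σ τ (Finsupp.single (τ k) c) = Finsupp.single (σ k) c := by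
  simp [partialShift, Finsupp.lcomapDomain]

theorem partialShift_apply_single_of_notMem (σ : κ ↪ Y) {τ : κ ↪ Y} {y : Y}
    (hy : y ∉ Set.range τ) (c : T) : partialShift T σ τ (Finsupp.single y c) = 0 := by
  have hcomap : Finsupp.lcomapDomain (R := Tᵐᵒᵖ) τ τ.injective (Finsupp.single y c) = 0 := by
    ext k
    exact Finsupp.single_eq_of_ne fun h => hy ⟨k, h⟩
  rw [partialShift, LinearMap.comp_apply, hcomap, map_zero]

theorem partialShift_apply_eq_zero {σ : κ ↪ Y} (τ : κ ↪ Y) {y : Y} (hy : y ∉ Set.range σ)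
    (f : Y →₀ T) : partialShift T σ τ f y = 0 :=
  Finsupp.mapDomain_of_notMem_range _ _ hy

theorem matrixUnit_apply (y z : Y) (t : T) (f : Y →₀ T) :
    matrixUnit y z t f = Finsupp.single y (t * f z) :=
  rfl

theorem partialShift_mul_partialShift (σ τ ρ : κ ↪ Y) :
    partialShift T σ τ * partialShift T τ ρ = partialShift T σ ρ := by
  refine Finsupp.lhom_ext fun y c => ?_
  rw [Module.End.mul_apply]
  by_cases hy : y ∈ Set.range ρ
  · obtain ⟨k, rfl⟩ := hy
    simp only [partialShift_apply_single]
  · simp only [partialShift_apply_single_of_notMem _ hy, map_zero]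

theorem partialShift_mul_partialShift_of_disjoint {κ' : Type*} (σ : κ ↪ Y) {τ : κ ↪ Y}
    {τ' : κ' ↪ Y} (ρ : κ' ↪ Y) (h : Disjoint (Set.range τ) (Set.range τ')) :
    partialShift T σ τ * partialShift T τ' ρ = 0 := by
  refine Finsupp.lhom_ext fun y c => ?_
  rw [Module.End.mul_apply]
  by_cases hy : y ∈ Set.range ρ
  · obtain ⟨k, rfl⟩ := hy
    rw [partialShift_apply_single,
      partialShift_apply_single_of_notMem _ (h.notMem_of_mem_right ⟨k, rfl⟩),
      LinearMap.zero_apply]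
  · rw [partialShift_apply_single_of_notMem _ hy, map_zero, LinearMap.zero_apply]

theorem partialShift_self_apply_single (ρ : κ ↪ Y) {y : Y} (hy : y ∈ Set.range ρ) (c : T) :
    partialShift T ρ ρ (Finsupp.single y c) = Finsupp.single y c := by
  obtain ⟨k, rfl⟩ := hy
  exact partialShift_apply_single ρ ρ k c

theorem partialShift_self_mul {σ ρ : κ ↪ Y} (τ : κ ↪ Y) (h : Set.range σ ⊆ Set.range ρ) :
    partialShift T ρ ρ * partialShift T σ τ = partialShift T σ τ := by
  refine Finsupp.lhom_ext fun y c => ?_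
  rw [Module.End.mul_apply]
  by_cases hy : y ∈ Set.range τ
  · obtain ⟨k, rfl⟩ := hy
    rw [partialShift_apply_single, partialShift_self_apply_single ρ (h ⟨k, rfl⟩)]
  · rw [partialShift_apply_single_of_notMem _ hy, map_zero]

theorem partialShift_mul_self (σ : κ ↪ Y) {τ ρ : κ ↪ Y} (h : Set.range τ ⊆ Set.range ρ) :
    partialShift T σ τ * partialShift T ρ ρ = partialShift T σ τ := by
  refine Finsupp.lhom_ext fun y c => ?_
  rw [Module.End.mul_apply]
  by_cases hy : y ∈ Set.range ρ
  · rw [partialShift_self_apply_single ρ hy]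
  · rw [partialShift_apply_single_of_notMem _ hy, map_zero,
      partialShift_apply_single_of_notMem _ fun hτ => hy (h hτ)]

theorem IsRangePartition.sum_partialShift {ι : Type*} {s : Finset ι} {f : ι → κ ↪ Y} {ρ : κ ↪ Y}
    (h : IsRangePartition s f ρ) :
    ∑ a ∈ s, partialShift T (f a) (f a) = partialShift T ρ ρ := by
  refine Finsupp.lhom_ext fun y c => ?_
  rw [LinearMap.sum_apply]
  by_cases hy : y ∈ Set.range ρ
  · obtain ⟨a, ha, hya⟩ : ∃ a ∈ s, y ∈ Set.range (f a) := by
      simpa only [← h.iUnion_range, Set.mem_iUnion, exists_prop] using hy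
    rw [Finset.sum_eq_single_of_mem a ha fun b hb hba =>
      partialShift_apply_single_of_notMem _
        ((h.pairwiseDisjoint hb ha hba).notMem_of_mem_right hya) c,
      partialShift_self_apply_single _ hya, partialShift_self_apply_single _ hy]
  · rw [partialShift_apply_single_of_notMem _ hy]
    exact Finset.sum_eq_zero fun a ha =>
      partialShift_apply_single_of_notMem _ (fun hya => hy (h.range_subset ha hya)) c

theorem partialShift_mul_matrixUnit (σ τ : κ ↪ Y) (k : κ) (z : Y) (t : T) :
    partialShift T σ τ * matrixUnit (τ k) z t = matrixUnit (σ k) z t := by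
  refine LinearMap.ext fun f => ?_
  rw [Module.End.mul_apply, matrixUnit_apply, matrixUnit_apply, partialShift_apply_single]

theorem partialShift_mul_matrixUnit_of_notMem (σ : κ ↪ Y) {τ : κ ↪ Y} {y : Y}
    (hy : y ∉ Set.range τ) (z : Y) (t : T) : partialShift T σ τ * matrixUnit y z t = 0 := by
  refine LinearMap.ext fun f => ?_
  rw [Module.End.mul_apply, matrixUnit_apply, partialShift_apply_single_of_notMem _ hy,
    LinearMap.zero_apply]

theorem matrixUnit_mul_partialShift_self {ρ : κ ↪ Y} (y : Y) {z : Y} (hz : z ∈ Set.range ρ)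
    (t : T) : matrixUnit y z t * partialShift T ρ ρ = matrixUnit y z t := by
  obtain ⟨k, rfl⟩ := hz
  refine LinearMap.ext fun f => ?_
  rw [Module.End.mul_apply, matrixUnit_apply, matrixUnit_apply, partialShift,
    LinearMap.comp_apply, Finsupp.lmapDomain_apply, Finsupp.mapDomain_apply ρ.injective]
  rfl

theorem matrixUnit_mul_partialShift_of_notMem {σ : κ ↪ Y} (τ : κ ↪ Y) (y : Y) {z : Y}
    (hz : z ∉ Set.range σ) (t : T) : matrixUnit y z t * partialShift T σ τ = 0 := by
  refine LinearMap.ext fun f => ?_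
  rw [Module.End.mul_apply, matrixUnit_apply, partialShift_apply_eq_zero τ hz, mul_zero,
    Finsupp.single_zero, LinearMap.zero_apply]

theorem commute_toModuleEnd_partialShift (r : T) (σ τ : κ ↪ Y) :
    Commute (Module.toModuleEnd Tᵐᵒᵖ (Y →₀ T) r) (partialShift T σ τ) := by
  refine Finsupp.lhom_ext fun y c => ?_
  by_cases hy : y ∈ Set.range τ
  · obtain ⟨k, rfl⟩ := hy
    simp only [Module.End.mul_apply, Module.toModuleEnd_apply, DistribSMul.toLinearMap_apply,
      Finsupp.smul_single, partialShift_apply_single]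
  · simp only [Module.End.mul_apply, Module.toModuleEnd_apply, DistribSMul.toLinearMap_apply,
      Finsupp.smul_single, partialShift_apply_single_of_notMem σ hy, smul_zero]

theorem commute_toModuleEnd_matrixUnit {r t : T} (h : Commute r t) (y z : Y) :
    Commute (Module.toModuleEnd Tᵐᵒᵖ (Y →₀ T) r) (matrixUnit y z t) := by
  refine LinearMap.ext fun f => ?_
  simp only [Module.End.mul_apply, Module.toModuleEnd_apply, DistribSMul.toLinearMap_apply,
    matrixUnit_apply, Finsupp.smul_single, Finsupp.smul_apply, smul_eq_mul, ← mul_assoc, h.eq]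

theorem exists_mul_mul_eq_of_row_of_column {a b : Module.End Tᵐᵒᵖ (Y →₀ T)} (hab : a * b * a = a)
    {y z : Y} {t : T} (hcol : a (Finsupp.single z 1) = Finsupp.single y t)
    (hrow : ∀ f, a f y = t * f z) : ∃ c, t * c * t = t := by
  refine ⟨b (Finsupp.single y 1) z, ?_⟩
  have hsingle : Finsupp.single y t = MulOpposite.op t • Finsupp.single y (1 : T) := by simp
  calc t * b (Finsupp.single y 1) z * t = t * b (Finsupp.single y t) z := by
        rw [hsingle, map_smul, Finsupp.smul_apply, op_smul_eq_mul, mul_assoc]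
    _ = (a * b * a) (Finsupp.single z 1) y := by
        rw [Module.End.mul_apply, Module.End.mul_apply, hcol, hrow]
    _ = t := by rw [hab, hcol, Finsupp.single_eq_same]

end MonomialMaps

theorem IsVonNeumannRegular.isGradedVonNeumannRegular {ι A : Type*} [DecidableEq ι] [Add ι]
    [NonUnitalRing A] (h : IsVonNeumannRegular A) (𝒜 : ι → AddSubgroup A) [SetLike.GradedMul 𝒜]
    [DirectSum.Decomposition 𝒜] : IsGradedVonNeumannRegular 𝒜 :=
  fun a _ => h a

namespace WeightedGraph

variable {V S : Type*} {E : WeightedGraph V S}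

theorem mem_out {v : V} {α : S} : α ∈ E.out v ↔ E.src α = v := by simp [out]

theorem lt_maxWeight_iff {v : V} {i : ℕ} :
    i < E.maxWeight v ↔ ∃ α ∈ E.out v, i < E.weight α :=
  Finset.lt_sup_iff

theorem lt_maxWeight_src {α : S} {i : ℕ} (hi : i < E.weight α) : i < E.maxWeight (E.src α) :=
  lt_maxWeight_iff.2 ⟨α, mem_out.2 rfl, hi⟩

theorem IsLV.exists_ne_src_eq (hE : E.IsLV) : ∃ α β, α ≠ β ∧ E.src β = E.src α := by
  obtain ⟨γ⟩ := hE.nonempty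
  obtain ⟨α, hα, β, hβ, hαβ⟩ :=
    Finset.one_lt_card.1 (hE.two_le_card (E.src γ) ⟨γ, mem_out.2 rfl⟩)
  rw [Finset.mem_filter, mem_out] at hα hβ
  exact ⟨α, β, hαβ, hβ.1.trans hα.1.symm⟩

open Classical in
/-- A family of elements of a ring `B` indexed by the letters that satisfies the defining relations
of the weighted Leavitt path algebra. As in `freeEdge` and `freeGhost`, edges and ghost edges are
indexed by all natural numbers and vanish beyond the weight. -/
structure LeavittFamily (E : WeightedGraph V S) (B : Type*) [Ring B] where
  vertex : V → B
  edge : S → ℕ → B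
  ghost : S → ℕ → B
  edge_eq_zero : ∀ α i, E.weight α ≤ i → edge α i = 0
  ghost_eq_zero : ∀ α i, E.weight α ≤ i → ghost α i = 0
  vertex_mul : ∀ v w, vertex v * vertex w = if v = w then vertex v else 0
  src_mul_edge : ∀ α i, vertex (E.src α) * edge α i = edge α i
  edge_mul_tgt : ∀ α i, edge α i * vertex (E.tgt α) = edge α i
  tgt_mul_ghost : ∀ α i, vertex (E.tgt α) * ghost α i = ghost α i
  ghost_mul_src : ∀ α i, ghost α i * vertex (E.src α) = ghost α i
  sum_edge_mul_ghost : ∀ v i j, i < E.maxWeight v → j < E.maxWeight v →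
    ∑ α ∈ E.out v, edge α i * ghost α j = if i = j then vertex v else 0
  sum_ghost_mul_edge : ∀ α β,
    ∑ i ∈ Finset.range (max (E.weight α) (E.weight β)), ghost α i * edge β i =
      if α = β then vertex (E.tgt α) else 0

namespace LeavittFamily

variable {B : Type*} [Ring B] (F : LeavittFamily E B)

open Classical in
theorem sum_range_ghost_mul_edge {α β : S} {n : ℕ} (hα : E.weight α ≤ n) (hβ : E.weight β ≤ n) :
    ∑ i ∈ Finset.range n, F.ghost α i * F.edge β i = if α = β then F.vertex (E.tgt α) else 0 := by
  rw [← F.sum_ghost_mul_edge]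
  refine Finset.eventually_constant_sum (fun i hi => ?_) (max_le hα hβ)
  rw [F.ghost_eq_zero α i ((le_max_left _ _).trans hi), zero_mul]

/-- An element commuting with all members of the family. -/
structure IsCentralizedBy (b : B) : Prop where
  vertex : ∀ v, Commute b (F.vertex v)
  edge : ∀ α i, Commute b (F.edge α i)
  ghost : ∀ α i, Commute b (F.ghost α i)

/-- The member of the family that belongs to a letter. -/
def letter : E.Letter → B
  | .vertex v => F.vertex v
  | .edge α i => F.edge α i
  | .ghost α i => F.ghost α i

section Lift

variable {F} in
theorem IsCentralizedBy.commute_word {b : B} (hb : F.IsCentralizedBy b)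
    (w : FreeSemigroup E.Letter) : Commute b (FreeSemigroup.lift F.letter w) := by
  induction w using FreeSemigroup.recOnMul with
  | ih1 x =>
    cases x with
    | vertex v => exact hb.vertex v
    | edge α i => exact hb.edge α i
    | ghost α i => exact hb.ghost α i
  | ih2 x y hx hy => rw [map_mul]; exact hx.mul_right hy

variable {R : Type*} [Ring R] (f : R →+* B) (hf : ∀ r, F.IsCentralizedBy (f r))

/-- The homomorphism from the free `R`-ring induced by a family and by a homomorphism `f` on
scalars with values in the centralizer of the family. -/
noncomputable def freeLift : E.FreeRRing R →ₙ+* B where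
  __ := MonoidAlgebra.liftNC (f : R →+ B) (FreeSemigroup.lift F.letter)
  map_mul' x y := MonoidAlgebra.liftNC_mul f _ x y fun _ => (hf _).commute_word _

theorem freeLift_single (w : FreeSemigroup E.Letter) (r : R) :
    F.freeLift f hf (MonoidAlgebra.single w r) = f r * FreeSemigroup.lift F.letter w :=
  MonoidAlgebra.liftNC_single _ _ _ _

theorem freeLift_freeVertex (v : V) : F.freeLift f hf (E.freeVertex R v) = F.vertex v := by
  rw [freeVertex, freeLift_single, map_one, one_mul, FreeSemigroup.lift_of, letter]

theorem freeLift_freeEdge (α : S) (i : ℕ) : F.freeLift f hf (E.freeEdge R α i) = F.edge α i := by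
  rw [freeEdge]
  split_ifs with h
  · rw [freeLift_single, map_one, one_mul, FreeSemigroup.lift_of, letter]
  · rw [map_zero, F.edge_eq_zero α i (not_lt.1 h)]

theorem freeLift_freeGhost (α : S) (i : ℕ) :
    F.freeLift f hf (E.freeGhost R α i) = F.ghost α i := by
  rw [freeGhost]
  split_ifs with h
  · rw [freeLift_single, map_one, one_mul, FreeSemigroup.lift_of, letter]
  · rw [map_zero, F.ghost_eq_zero α i (not_lt.1 h)]

theorem freeLift_smul (r : R) (x : E.FreeRRing R) :
    F.freeLift f hf (r • x) = f r * F.freeLift f hf x := by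
  induction x using MonoidAlgebra.induction_linear with
  | zero => simp only [smul_zero, map_zero, mul_zero]
  | add x y hx hy => rw [smul_add, map_add, map_add, hx, hy, mul_add]
  | single w s =>
    rw [MonoidAlgebra.smul_single, freeLift_single, freeLift_single, smul_eq_mul, map_mul,
      mul_assoc]

theorem freeLift_op_smul (r : R) (x : E.FreeRRing R) :
    F.freeLift f hf (MulOpposite.op r • x) = F.freeLift f hf x * f r := by
  induction x using MonoidAlgebra.induction_linear with
  | zero => simp only [smul_zero, map_zero, zero_mul]
  | add x y hx hy => rw [smul_add, map_add, map_add, hx, hy, add_mul]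
  | single w s =>
    rw [MonoidAlgebra.smul_single, freeLift_single, freeLift_single, op_smul_eq_mul, map_mul,
      mul_assoc, mul_assoc, ((hf r).commute_word w).eq]

theorem freeLift_eq_of_rel {x y : E.FreeRRing R} (h : E.Rel R x y) :
    F.freeLift f hf x = F.freeLift f hf y := by
  cases h <;>
    simp only [map_mul, map_sum, freeLift_freeVertex, freeLift_freeEdge, freeLift_freeGhost,
      apply_ite (F.freeLift f hf), map_zero]
  case vertex_mul v w => exact F.vertex_mul v w
  case src_mul_edge α i _ => exact F.src_mul_edge α i
  case edge_mul_tgt α i _ => exact F.edge_mul_tgt α i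
  case tgt_mul_ghost α i _ => exact F.tgt_mul_ghost α i
  case ghost_mul_src α i _ => exact F.ghost_mul_src α i
  case sum_edge_mul_ghost v i j hi hj => exact F.sum_edge_mul_ghost v i j hi hj
  case sum_ghost_mul_edge α β => exact F.sum_ghost_mul_edge α β

theorem relIdeal_le_ker_freeLift : E.relIdeal R ≤ TwoSidedIdeal.ker (F.freeLift f hf) := by
  refine sInf_le ⟨fun x y h => ?_, fun r x hx => ?_⟩
  · rw [TwoSidedIdeal.mem_ker, map_sub, F.freeLift_eq_of_rel f hf h, sub_self]
  · rw [TwoSidedIdeal.mem_ker] at hx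
    simp only [TwoSidedIdeal.mem_ker, freeLift_smul, freeLift_op_smul, hx, mul_zero, zero_mul,
      and_self]

/-- The homomorphism from the weighted Leavitt path algebra induced by a family and by a
homomorphism `f` on scalars with values in the centralizer of the family. -/
noncomputable def lift : E.LeavittPathAlgebra R →ₙ+* B where
  toFun := Quotient.lift (F.freeLift f hf) fun x y h => sub_eq_zero.1 <| by
    rw [← map_sub, ← TwoSidedIdeal.mem_ker]
    exact F.relIdeal_le_ker_freeLift f hf ((TwoSidedIdeal.rel_iff _ _ _).1 h)
  map_mul' := Quotient.ind₂ (map_mul (F.freeLift f hf))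
  map_zero' := map_zero (F.freeLift f hf)
  map_add' := Quotient.ind₂ (map_add (F.freeLift f hf))

theorem lift_toLeavitt_freeEdge (α : S) (i : ℕ) :
    F.lift f hf (E.toLeavitt R (E.freeEdge R α i)) = F.edge α i :=
  F.freeLift_freeEdge f hf α i

end Lift

/-- The condition on `x` under which adding `β x` to the column `α` of the edge matrix at the
common source of `α` and `β`, and subtracting `x α*` from the row `β` of its inverse, respects
sources, ranges and weights. -/
structure IsTransvectionCoeff (α β : S) (x : B) : Prop where
  ne : α ≠ β
  src_eq : E.src β = E.src α
  tgt_mul : F.vertex (E.tgt β) * x = x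
  mul_tgt : x * F.vertex (E.tgt α) = x
  edge_mul : ∀ i, E.weight α ≤ i → F.edge β i * x = 0
  mul_ghost : ∀ i, E.weight β ≤ i → x * F.ghost α i = 0

section Transvection

variable {α β : S} {x : B}

open Classical in
/-- The edges `γ_i` after adding `β_i x` to `α_i`. -/
noncomputable def transvectionEdge (α β : S) (x : B) (γ : S) (i : ℕ) : B :=
  F.edge γ i + F.edge β i * if γ = α then x else 0

open Classical in
/-- The ghost edges `γ_i*` after subtracting `x α_i*` from `β_i*`. -/
noncomputable def transvectionGhost (α β : S) (x : B) (γ : S) (i : ℕ) : B :=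
  F.ghost γ i - (if γ = β then x else 0) * F.ghost α i

theorem transvectionEdge_self (i : ℕ) :
    F.transvectionEdge α β x α i = F.edge α i + F.edge β i * x := by
  rw [transvectionEdge, if_pos rfl]

theorem transvectionEdge_of_ne {γ : S} (hγ : γ ≠ α) (i : ℕ) :
    F.transvectionEdge α β x γ i = F.edge γ i := by
  rw [transvectionEdge, if_neg hγ, mul_zero, add_zero]

theorem transvectionGhost_self (i : ℕ) :
    F.transvectionGhost α β x β i = F.ghost β i - x * F.ghost α i := by
  rw [transvectionGhost, if_pos rfl]

theorem transvectionGhost_of_ne {γ : S} (hγ : γ ≠ β) (i : ℕ) :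
    F.transvectionGhost α β x γ i = F.ghost γ i := by
  rw [transvectionGhost, if_neg hγ, zero_mul, sub_zero]

namespace IsTransvectionCoeff

variable {F} (h : F.IsTransvectionCoeff α β x)
include h

theorem transvectionEdge_eq_zero (γ : S) (i : ℕ) (hi : E.weight γ ≤ i) :
    F.transvectionEdge α β x γ i = 0 := by
  obtain rfl | hγ := eq_or_ne γ α
  · rw [transvectionEdge_self, F.edge_eq_zero γ i hi, h.edge_mul i hi, add_zero]
  · rw [transvectionEdge_of_ne F hγ, F.edge_eq_zero γ i hi]

theorem transvectionGhost_eq_zero (γ : S) (i : ℕ) (hi : E.weight γ ≤ i) :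
    F.transvectionGhost α β x γ i = 0 := by
  obtain rfl | hγ := eq_or_ne γ β
  · rw [transvectionGhost_self, F.ghost_eq_zero γ i hi, h.mul_ghost i hi, sub_zero]
  · rw [transvectionGhost_of_ne F hγ, F.ghost_eq_zero γ i hi]

theorem src_mul_transvectionEdge (γ : S) (i : ℕ) :
    F.vertex (E.src γ) * F.transvectionEdge α β x γ i = F.transvectionEdge α β x γ i := by
  obtain rfl | hγ := eq_or_ne γ α
  · rw [transvectionEdge_self, mul_add, F.src_mul_edge, ← h.src_eq, ← mul_assoc, F.src_mul_edge]
  · rw [transvectionEdge_of_ne F hγ, F.src_mul_edge]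

theorem transvectionEdge_mul_tgt (γ : S) (i : ℕ) :
    F.transvectionEdge α β x γ i * F.vertex (E.tgt γ) = F.transvectionEdge α β x γ i := by
  obtain rfl | hγ := eq_or_ne γ α
  · rw [transvectionEdge_self, add_mul, F.edge_mul_tgt, mul_assoc, h.mul_tgt]
  · rw [transvectionEdge_of_ne F hγ, F.edge_mul_tgt]

theorem tgt_mul_transvectionGhost (γ : S) (i : ℕ) :
    F.vertex (E.tgt γ) * F.transvectionGhost α β x γ i = F.transvectionGhost α β x γ i := by
  obtain rfl | hγ := eq_or_ne γ β
  · rw [transvectionGhost_self, mul_sub, F.tgt_mul_ghost, ← mul_assoc, h.tgt_mul]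
  · rw [transvectionGhost_of_ne F hγ, F.tgt_mul_ghost]

theorem transvectionGhost_mul_src (γ : S) (i : ℕ) :
    F.transvectionGhost α β x γ i * F.vertex (E.src γ) = F.transvectionGhost α β x γ i := by
  obtain rfl | hγ := eq_or_ne γ β
  · rw [transvectionGhost_self, sub_mul, F.ghost_mul_src, h.src_eq, mul_assoc, F.ghost_mul_src]
  · rw [transvectionGhost_of_ne F hγ, F.ghost_mul_src]

theorem sum_transvectionEdge_mul_transvectionGhost (v : V) (i j : ℕ) :
    ∑ γ ∈ E.out v, F.transvectionEdge α β x γ i * F.transvectionGhost α β x γ j =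
      ∑ γ ∈ E.out v, F.edge γ i * F.ghost γ j := by
  classical
  have hexpand (γ : S) : F.transvectionEdge α β x γ i * F.transvectionGhost α β x γ j =
      F.edge γ i * F.ghost γ j - (if γ = β then F.edge β i * x * F.ghost α j else 0) +
        if γ = α then F.edge β i * x * F.ghost α j else 0 := by
    obtain rfl | hα := eq_or_ne γ α
    · rw [transvectionEdge_self, transvectionGhost_of_ne F h.ne, if_neg h.ne, if_pos rfl, add_mul,
        sub_zero]
    obtain rfl | hβ := eq_or_ne γ β
    · rw [transvectionEdge_of_ne F hα, transvectionGhost_self, if_pos rfl, if_neg hα, mul_sub,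
        mul_assoc, add_zero]
    · rw [transvectionEdge_of_ne F hα, transvectionGhost_of_ne F hβ, if_neg hα, if_neg hβ, sub_zero,
        add_zero]
  simp only [hexpand, Finset.sum_add_distrib, Finset.sum_sub_distrib, Finset.sum_ite_eq', mem_out,
    h.src_eq, sub_add_cancel]

open Classical in
theorem sum_transvectionGhost_mul_transvectionEdge (γ δ : S) :
    ∑ i ∈ Finset.range (max (E.weight γ) (E.weight δ)),
      F.transvectionGhost α β x γ i * F.transvectionEdge α β x δ i =
        if γ = δ then F.vertex (E.tgt γ) else 0 := by
  let n := max (max (E.weight γ) (E.weight δ)) (max (E.weight α) (E.weight β))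
  have hγ : E.weight γ ≤ n := (le_max_left _ _).trans (le_max_left _ _)
  have hδ : E.weight δ ≤ n := (le_max_right _ _).trans (le_max_left _ _)
  have hα : E.weight α ≤ n := (le_max_left _ _).trans (le_max_right _ _)
  have hβ : E.weight β ≤ n := (le_max_right _ _).trans (le_max_right _ _)
  let p := if γ = β then x else 0
  let q := if δ = α then x else 0
  calc
    _ = ∑ i ∈ Finset.range n, F.transvectionGhost α β x γ i * F.transvectionEdge α β x δ i :=
      (Finset.eventually_constant_sum (fun i hi => by
        rw [h.transvectionGhost_eq_zero γ i ((le_max_left _ _).trans hi), zero_mul])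
        (le_max_left _ _)).symm
    _ = ∑ i ∈ Finset.range n, F.ghost γ i * F.edge δ i +
          (∑ i ∈ Finset.range n, F.ghost γ i * F.edge β i) * q -
          p * ∑ i ∈ Finset.range n, F.ghost α i * F.edge δ i -
          p * (∑ i ∈ Finset.range n, F.ghost α i * F.edge β i) * q := by
      simp only [transvectionGhost, transvectionEdge, sub_mul, mul_add, Finset.sum_sub_distrib,
        Finset.sum_add_distrib, Finset.mul_sum, Finset.sum_mul, mul_assoc, p, q]
      abel
    _ = if γ = δ then F.vertex (E.tgt γ) else 0 := by
      rw [F.sum_range_ghost_mul_edge hγ hδ, F.sum_range_ghost_mul_edge hγ hβ,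
        F.sum_range_ghost_mul_edge hα hδ, F.sum_range_ghost_mul_edge hα hβ, if_neg h.ne, mul_zero,
        zero_mul, sub_zero, add_sub_assoc, add_eq_left, sub_eq_zero]
      by_cases hγβ : γ = β <;> by_cases hδα : δ = α
      · simp only [p, q, hγβ, hδα, if_true, h.tgt_mul, h.mul_tgt]
      · simp only [p, q, hγβ, hδα, Ne.symm hδα, if_true, if_false, mul_zero]
      · simp only [p, q, hγβ, if_false, zero_mul]
      · simp only [p, q, hγβ, if_false, zero_mul]

/-- The family obtained by the elementary column operation that adds `β x` to the column `α`. -/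
noncomputable def transvection : LeavittFamily E B where
  vertex := F.vertex
  edge := F.transvectionEdge α β x
  ghost := F.transvectionGhost α β x
  edge_eq_zero := h.transvectionEdge_eq_zero
  ghost_eq_zero := h.transvectionGhost_eq_zero
  vertex_mul := F.vertex_mul
  src_mul_edge := h.src_mul_transvectionEdge
  edge_mul_tgt := h.transvectionEdge_mul_tgt
  tgt_mul_ghost := h.tgt_mul_transvectionGhost
  ghost_mul_src := h.transvectionGhost_mul_src
  sum_edge_mul_ghost v i j hi hj :=
    (h.sum_transvectionEdge_mul_transvectionGhost v i j).trans (F.sum_edge_mul_ghost v i j hi hj)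
  sum_ghost_mul_edge := h.sum_transvectionGhost_mul_transvectionEdge

theorem transvection_edge_self (i : ℕ) : h.transvection.edge α i = F.edge α i + F.edge β i * x :=
  F.transvectionEdge_self i

theorem isCentralizedBy_transvection {b : B} (hb : F.IsCentralizedBy b) (hbx : Commute b x) :
    h.transvection.IsCentralizedBy b where
  vertex := hb.vertex
  edge γ i := by
    refine (hb.edge γ i).add_right ((hb.edge β i).mul_right ?_)
    split_ifs
    exacts [hbx, Commute.zero_right b]
  ghost γ i := by
    refine (hb.ghost γ i).sub_right (Commute.mul_right ?_ (hb.ghost α i))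
    split_ifs
    exacts [hbx, Commute.zero_right b]

end IsTransvectionCoeff

end Transvection

end LeavittFamily

/-- A branching system of `E` on `V × ℕ`: for `i < ω(v)` the embeddings `row α i` cut `{v} × ℕ` into
pieces indexed by the edges `α` from `v` with `i < ω(α)`, and for each `α` the embeddings `col α i`
cut `{r(α)} × ℕ` into pieces indexed by `i < ω(α)`. The edge `α_i` will act by
`col α i k ↦ row α i k`. The values of `row α` and `col α` beyond the weight of `α` are
irrelevant. -/
structure BranchingSystem (E : WeightedGraph V S) where
  row : S → ℕ → ℕ ↪ V × ℕ
  col : S → ℕ → ℕ ↪ V × ℕ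
  isRangePartition_row : ∀ v i, i < E.maxWeight v →
    IsRangePartition {α ∈ E.out v | i < E.weight α} (fun α => row α i) (.sectR v ℕ)
  isRangePartition_col : ∀ α,
    IsRangePartition (Finset.range (E.weight α)) (col α) (.sectR (E.tgt α) ℕ)

theorem nonempty_branchingSystem (E : WeightedGraph V S) : Nonempty (BranchingSystem E) := by
  have hrow (v : V) (i : ℕ) : ∃ σ : S → ℕ ↪ V × ℕ, i < E.maxWeight v →
      IsRangePartition {α ∈ E.out v | i < E.weight α} σ (.sectR v ℕ) := by
    by_cases hi : i < E.maxWeight v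
    · obtain ⟨σ, hσ⟩ := exists_isRangePartition (s := {α ∈ E.out v | i < E.weight α})
        (Finset.filter_nonempty_iff.2 (lt_maxWeight_iff.1 hi)) (.sectR v ℕ)
      exact ⟨σ, fun _ => hσ⟩
    · exact ⟨fun _ => .sectR v ℕ, fun h => absurd h hi⟩
  choose row hrow using hrow
  choose col hcol using fun α => exists_isRangePartition
    (Finset.nonempty_range_iff.2 (E.weight_pos α).ne') (.sectR (E.tgt α) ℕ)
  refine ⟨⟨fun α i => row (E.src α) i α, col, fun v i hi => ?_, hcol⟩⟩
  have hsrc : ∀ α ∈ ({α ∈ E.out v | i < E.weight α} : Finset S), E.src α = v := fun α hα =>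
    mem_out.1 (Finset.mem_filter.1 hα).1
  refine (hrow v i hi).congr fun α hα => ?_
  rw [hsrc α hα]

namespace BranchingSystem

variable (Φ : BranchingSystem E)

theorem range_row_subset {α : S} {i : ℕ} (hi : i < E.weight α) :
    Set.range (Φ.row α i) ⊆ Set.range (Function.Embedding.sectR (E.src α) ℕ) :=
  (Φ.isRangePartition_row (E.src α) i (lt_maxWeight_src hi)).range_subset
    (Finset.mem_filter.2 ⟨mem_out.2 rfl, hi⟩)

theorem range_col_subset {α : S} {i : ℕ} (hi : i < E.weight α) :
    Set.range (Φ.col α i) ⊆ Set.range (Function.Embedding.sectR (E.tgt α) ℕ) :=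
  (Φ.isRangePartition_col α).range_subset (Finset.mem_range.2 hi)

theorem disjoint_range_col {α : S} {i j : ℕ} (hi : i < E.weight α) (hj : j < E.weight α)
    (hij : i ≠ j) : Disjoint (Set.range (Φ.col α i)) (Set.range (Φ.col α j)) :=
  (Φ.isRangePartition_col α).pairwiseDisjoint (Finset.mem_coe.2 (Finset.mem_range.2 hi))
    (Finset.mem_coe.2 (Finset.mem_range.2 hj)) hij

theorem disjoint_range_row {α β : S} {i : ℕ} (hα : i < E.weight α) (hβ : i < E.weight β)
    (hαβ : α ≠ β) : Disjoint (Set.range (Φ.row α i)) (Set.range (Φ.row β i)) := by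
  by_cases hsrc : E.src α = E.src β
  · exact (Φ.isRangePartition_row (E.src β) i (lt_maxWeight_src hβ)).pairwiseDisjoint
      (Finset.mem_coe.2 (Finset.mem_filter.2 ⟨mem_out.2 hsrc, hα⟩))
      (Finset.mem_coe.2 (Finset.mem_filter.2 ⟨mem_out.2 rfl, hβ⟩)) hαβ
  · exact (disjoint_range_sectR ℕ hsrc).mono (Φ.range_row_subset hα) (Φ.range_row_subset hβ)

section Family

variable (T : Type*) [Ring T]

/-- The edge `α_i` acting by `col α i k ↦ row α i k`. -/
noncomputable def edge (α : S) (i : ℕ) : Module.End Tᵐᵒᵖ (V × ℕ →₀ T) :=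
  if i < E.weight α then partialShift T (Φ.row α i) (Φ.col α i) else 0

/-- The ghost edge `α_i*` acting by `row α i k ↦ col α i k`. -/
noncomputable def ghost (α : S) (i : ℕ) : Module.End Tᵐᵒᵖ (V × ℕ →₀ T) :=
  if i < E.weight α then partialShift T (Φ.col α i) (Φ.row α i) else 0

theorem edge_eq {α : S} {i : ℕ} (hi : i < E.weight α) :
    Φ.edge T α i = partialShift T (Φ.row α i) (Φ.col α i) :=
  if_pos hi

theorem edge_eq_zero {α : S} {i : ℕ} (hi : E.weight α ≤ i) : Φ.edge T α i = 0 :=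
  if_neg hi.not_gt

theorem ghost_eq {α : S} {i : ℕ} (hi : i < E.weight α) :
    Φ.ghost T α i = partialShift T (Φ.col α i) (Φ.row α i) :=
  if_pos hi

theorem ghost_eq_zero {α : S} {i : ℕ} (hi : E.weight α ≤ i) : Φ.ghost T α i = 0 :=
  if_neg hi.not_gt

theorem edge_mul_ghost_of_ne (α : S) {i j : ℕ} (hij : i ≠ j) :
    Φ.edge T α i * Φ.ghost T α j = 0 := by
  obtain hi | hi := le_or_gt (E.weight α) i
  · rw [Φ.edge_eq_zero T hi, zero_mul]
  obtain hj | hj := le_or_gt (E.weight α) j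
  · rw [Φ.ghost_eq_zero T hj, mul_zero]
  rw [Φ.edge_eq T hi, Φ.ghost_eq T hj,
    partialShift_mul_partialShift_of_disjoint _ _ (Φ.disjoint_range_col hi hj hij)]

theorem ghost_mul_edge_of_ne {α β : S} (hαβ : α ≠ β) (i : ℕ) :
    Φ.ghost T α i * Φ.edge T β i = 0 := by
  obtain hα | hα := le_or_gt (E.weight α) i
  · rw [Φ.ghost_eq_zero T hα, zero_mul]
  obtain hβ | hβ := le_or_gt (E.weight β) i
  · rw [Φ.edge_eq_zero T hβ, mul_zero]
  rw [Φ.ghost_eq T hα, Φ.edge_eq T hβ,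
    partialShift_mul_partialShift_of_disjoint _ _ (Φ.disjoint_range_row hα hβ hαβ)]

open Classical in
theorem sum_edge_mul_ghost (v : V) {i : ℕ} (hi : i < E.maxWeight v) (j : ℕ) :
    ∑ α ∈ E.out v, Φ.edge T α i * Φ.ghost T α j =
      if i = j then partialShift T (.sectR v ℕ) (.sectR v ℕ) else 0 := by
  obtain rfl | hij := eq_or_ne i j
  · rw [if_pos rfl, ← (Φ.isRangePartition_row v i hi).sum_partialShift, Finset.sum_filter]
    refine Finset.sum_congr rfl fun α _ => ?_
    split_ifs with h
    · rw [Φ.edge_eq T h, Φ.ghost_eq T h, partialShift_mul_partialShift]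
    · rw [Φ.edge_eq_zero T (not_lt.1 h), zero_mul]
  · rw [if_neg hij]
    exact Finset.sum_eq_zero fun α _ => Φ.edge_mul_ghost_of_ne T α hij

open Classical in
theorem sum_ghost_mul_edge (α β : S) :
    ∑ i ∈ Finset.range (max (E.weight α) (E.weight β)), Φ.ghost T α i * Φ.edge T β i =
      if α = β then partialShift T (.sectR (E.tgt α) ℕ) (.sectR (E.tgt α) ℕ) else 0 := by
  obtain rfl | hαβ := eq_or_ne α β
  · rw [if_pos rfl, max_self, ← (Φ.isRangePartition_col α).sum_partialShift]
    refine Finset.sum_congr rfl fun i hi => ?_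
    rw [Finset.mem_range] at hi
    rw [Φ.ghost_eq T hi, Φ.edge_eq T hi, partialShift_mul_partialShift]
  · rw [if_neg hαβ]
    exact Finset.sum_eq_zero fun i _ => Φ.ghost_mul_edge_of_ne T hαβ i

open Classical in
/-- The family of partial shifts given by a branching system, in which the vertex `v` acts as the
projection onto `{v} × ℕ`. -/
noncomputable def family : LeavittFamily E (Module.End Tᵐᵒᵖ (V × ℕ →₀ T)) where
  vertex v := partialShift T (.sectR v ℕ) (.sectR v ℕ)
  edge := Φ.edge T
  ghost := Φ.ghost T
  edge_eq_zero _ _ := Φ.edge_eq_zero T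
  ghost_eq_zero _ _ := Φ.ghost_eq_zero T
  vertex_mul v w := by
    split_ifs with h
    · rw [h, partialShift_mul_partialShift]
    · exact partialShift_mul_partialShift_of_disjoint _ _ (disjoint_range_sectR ℕ h)
  src_mul_edge α i := by
    rw [edge, mul_ite, mul_zero]
    exact ite_congr rfl (fun h => partialShift_self_mul _ (Φ.range_row_subset h)) fun _ => rfl
  edge_mul_tgt α i := by
    rw [edge, ite_mul, zero_mul]
    exact ite_congr rfl (fun h => partialShift_mul_self _ (Φ.range_col_subset h)) fun _ => rfl
  tgt_mul_ghost α i := by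
    rw [ghost, mul_ite, mul_zero]
    exact ite_congr rfl (fun h => partialShift_self_mul _ (Φ.range_col_subset h)) fun _ => rfl
  ghost_mul_src α i := by
    rw [ghost, ite_mul, zero_mul]
    exact ite_congr rfl (fun h => partialShift_mul_self _ (Φ.range_row_subset h)) fun _ => rfl
  sum_edge_mul_ghost v i j hi _ := Φ.sum_edge_mul_ghost T v hi j
  sum_ghost_mul_edge := Φ.sum_ghost_mul_edge T

variable {T}

theorem isCentralizedBy_toModuleEnd (r : T) :
    (Φ.family T).IsCentralizedBy (Module.toModuleEnd Tᵐᵒᵖ (V × ℕ →₀ T) r) where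
  vertex _ := commute_toModuleEnd_partialShift r _ _
  edge α i := by
    change Commute _ (Φ.edge T α i)
    rw [edge]
    split_ifs
    exacts [commute_toModuleEnd_partialShift r _ _, Commute.zero_right _]
  ghost α i := by
    change Commute _ (Φ.ghost T α i)
    rw [ghost]
    split_ifs
    exacts [commute_toModuleEnd_partialShift r _ _, Commute.zero_right _]

theorem isTransvectionCoeff_matrixUnit {α β : S} (hαβ : α ≠ β) (hsrc : E.src β = E.src α)
    {i j : ℕ} (hj : j < E.weight β) (hi : i < E.weight α) (hjα : j < E.weight α)
    (hiβ : i < E.weight β) (k l : ℕ) (t : T) :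
    (Φ.family T).IsTransvectionCoeff α β (matrixUnit (Φ.col β j k) (Φ.col α i l) t) where
  ne := hαβ
  src_eq := hsrc
  tgt_mul := by
    obtain ⟨m, hm⟩ := Φ.range_col_subset hj ⟨k, rfl⟩
    rw [← hm]
    exact partialShift_mul_matrixUnit _ _ m _ t
  mul_tgt := matrixUnit_mul_partialShift_self _ (Φ.range_col_subset hi ⟨l, rfl⟩) t
  edge_mul n hn := by
    change Φ.edge T β n * _ = 0
    obtain hnβ | hnβ := le_or_gt (E.weight β) n
    · rw [Φ.edge_eq_zero T hnβ, zero_mul]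
    rw [Φ.edge_eq T hnβ]
    exact partialShift_mul_matrixUnit_of_notMem _
      ((Φ.disjoint_range_col hj hnβ (hjα.trans_le hn).ne).notMem_of_mem_left ⟨k, rfl⟩) _ t
  mul_ghost n hn := by
    change _ * Φ.ghost T α n = 0
    obtain hnα | hnα := le_or_gt (E.weight α) n
    · rw [Φ.ghost_eq_zero T hnα, mul_zero]
    rw [Φ.ghost_eq T hnα]
    exact matrixUnit_mul_partialShift_of_notMem _ _
      ((Φ.disjoint_range_col hi hnα (hiβ.trans_le hn).ne).notMem_of_mem_left ⟨l, rfl⟩) t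

end Family

end BranchingSystem

theorem exists_mul_mul_eq_of_freeEdge {α β : S} (hαβ : α ≠ β) (hsrc : E.src β = E.src α)
    (hα : 2 ≤ E.weight α) (hβ : 2 ≤ E.weight β) {R T : Type*} [Ring R] [Ring T] (f : R →+* T)
    {t : T} (ht : ∀ r, Commute (f r) t) {b : E.LeavittPathAlgebra R}
    (hb : E.toLeavitt R (E.freeEdge R α 0) * b * E.toLeavitt R (E.freeEdge R α 0) =
      E.toLeavitt R (E.freeEdge R α 0)) : ∃ c, t * c * t = t := by
  obtain ⟨Φ⟩ := nonempty_branchingSystem E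
  let y := Φ.row β 0 0
  let z := Φ.col α 1 0
  have hx := Φ.isTransvectionCoeff_matrixUnit hαβ hsrc (E.weight_pos β) hα (E.weight_pos α) hβ 0 0 t
  let L := hx.transvection.lift ((Module.toModuleEnd Tᵐᵒᵖ (V × ℕ →₀ T)).comp f) fun r =>
    hx.isCentralizedBy_transvection (Φ.isCentralizedBy_toModuleEnd (f r))
      (commute_toModuleEnd_matrixUnit (ht r) _ _)
  have hL : L (E.toLeavitt R (E.freeEdge R α 0)) =
      partialShift T (Φ.row α 0) (Φ.col α 0) + matrixUnit y z t := by
    rw [LeavittFamily.lift_toLeavitt_freeEdge, hx.transvection_edge_self]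
    change Φ.edge T α 0 + Φ.edge T β 0 * _ = _
    rw [Φ.edge_eq T (E.weight_pos α), Φ.edge_eq T (E.weight_pos β), partialShift_mul_matrixUnit]
  have hreg := congrArg L hb
  rw [map_mul, map_mul, hL] at hreg
  have hy : y ∉ Set.range (Φ.row α 0) :=
    (Φ.disjoint_range_row (E.weight_pos α) (E.weight_pos β) hαβ).notMem_of_mem_right ⟨0, rfl⟩
  have hz : z ∉ Set.range (Φ.col α 0) :=
    (Φ.disjoint_range_col (E.weight_pos α) hα zero_ne_one).notMem_of_mem_right ⟨0, rfl⟩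
  refine exists_mul_mul_eq_of_row_of_column hreg (y := y) (z := z) ?_ fun g => ?_
  · rw [LinearMap.add_apply, partialShift_apply_single_of_notMem _ hz, zero_add, matrixUnit_apply,
      Finsupp.single_eq_same, mul_one]
  · rw [LinearMap.add_apply, Finsupp.add_apply, partialShift_apply_eq_zero _ hy, zero_add,
      matrixUnit_apply, Finsupp.single_eq_same]

end WeightedGraph

theorem X_mul_mul_X_ne_X {R : Type*} [Ring R] [Nontrivial R] (p : Polynomial R) :
    Polynomial.X * p * Polynomial.X ≠ Polynomial.X := by
  intro h
  have hcoeff := congrArg (fun q => Polynomial.coeff q (0 + 1)) h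
  simp only [Polynomial.coeff_mul_X, Polynomial.mul_coeff_zero, Polynomial.coeff_X_zero, zero_mul,
    zero_add, Polynomial.coeff_X_one] at hcoeff
  exact zero_ne_one hcoeff

theorem mainTheorem12_general {V S : Type*} (E : WeightedGraph V S) {α β : S} (hαβ : α ≠ β)
    (hsrc : E.src β = E.src α) (hα : 2 ≤ E.weight α) (hβ : 2 ≤ E.weight β)
    (R : Type*) [Ring R] [Nontrivial R] :
    ¬ IsGradedVonNeumannRegular (E.component R) ∧
      ¬ IsVonNeumannRegular (E.LeavittPathAlgebra R) := by
  have hgraded : ¬ IsGradedVonNeumannRegular (E.component R) := by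
    intro hreg
    obtain ⟨b, hb⟩ := hreg _
      ⟨_, _, WeightedGraph.freeEdge_mem α 0 (E.weight_pos α), rfl⟩
    obtain ⟨p, hp⟩ := WeightedGraph.exists_mul_mul_eq_of_freeEdge hαβ hsrc hα hβ Polynomial.C
      (fun r => (Polynomial.commute_X (Polynomial.C r)).symm) hb
    exact X_mul_mul_X_ne_X p hp
  exact ⟨hgraded, fun h => hgraded (h.isGradedVonNeumannRegular _)⟩

theorem mainTheorem12 {V S : Type*} [Countable V] [Countable S] (E : WeightedGraph V S)
    (hE : E.IsLV) (R : Type*) [Ring R] [IsDomain R] :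
    ¬ IsGradedVonNeumannRegular (E.component R) ∧
      ¬ IsVonNeumannRegular (E.LeavittPathAlgebra R) := by
  obtain ⟨α, β, hαβ, hsrc⟩ := hE.exists_ne_src_eq
  exact mainTheorem12_general E hαβ hsrc (hE.two_le_weight α) (hE.two_le_weight β) R
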